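/- Let $n\ge 2$, let $(M,g)$ be an oriented $n$-dimensional smooth Riemannian manifold and let $x:M\to\mathbb E^{n+1}$ be a smooth isometric immersion. Let $L=\Delta x:M\to\mathbb E^{n+1}$ be its Laplace map, where $\Delta=-\operatorname{trace}\nabla^2$ is the Laplace operator of $(M,g)$ acting componentwise, and let $G:M\to S^n\subset\mathbb E^{n+1}$ be its Gauss map, given by the oriented unit normal. Assume that $L$ is an immersion. Then locally, on open sets $U\subset M$ on which $L$ is injective, there is a well-defined map $LG:L(U)\to G(U)$ with $LG(L(q))=G(q)$ for $q\in U$, where $L(U)$ has the smooth structure carried over from $U$ and the metric induced from $\mathbb E^{n+1}$. The map $LG$ is called weakly conformal if around every point of $M$ there is such a $U$ and a function $\rho\ge 0$ on $L(U)$ with $\langle d(LG)X,d(LG)Y\rangle=\rho^2\langle X,Y\rangle$ for all vectors $X,Y$ tangent to $L(U)$. The map $LG$ from the Laplace image to the Gauss image is weakly conformal if and only if every point of $M$ has an open neighbourhood on which either the mean curvature function $\alpha=\|H\|$, with $H=\frac1n\operatorname{trace}h$ and $h$ the second fundamental form, is constant, or $x$ is the product of a regular planar curve and an open part of an affine $(n-1)$-space,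 that is, up to a diffeomorphism of this neighbourhood onto $I\times W$, $x(t,v)=\gamma(t)+v$, where $V\subset\mathbb E^{n+1}$ is a linear subspace of dimension $n-1$, $W\subset V$ is open, $I$ is an open interval and $\gamma:I\to V^\perp$ is a smooth regular curve. -/

import Mathlib

open scoped Manifold ContDiff

namespace LaplaceGauss

/-- Euclidean `k`-space. -/
abbrev E (k : ℕ) : Type := EuclideanSpace ℝ (Fin k)

/-- The `i`-th standard basis vector of Euclidean space. -/
noncomputable abbrev e {k : ℕ} (i : Fin k) : E k := EuclideanSpace.single i (1 : ℝ)

/-- A smooth Riemannian metric on the `n`-dimensional manifold `M`. -/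
abbrev Metric (n : ℕ) (M : Type*) [TopologicalSpace M] [ChartedSpace (E n) M]
    [IsManifold (𝓡 n) ∞ M] : Type _ :=
  Bundle.ContMDiffRiemannianMetric (𝓡 n) ∞ (E n) (fun p : M => TangentSpace (𝓡 n) p)

section Manifold

variable {n : ℕ} {M : Type*} [TopologicalSpace M] [ChartedSpace (E n) M]

/-- The differential at `p` of a map from a manifold to a normed space `F`,
with values in `F`. -/
noncomputable def differential {F : Type*} [NormedAddCommGroup F] [NormedSpace ℝ F]
    (f : M → F) (p : M) : TangentSpace (𝓡 n) p →L[ℝ] F :=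
  mfderiv (𝓡 n) 𝓘(ℝ, F) f p

/-- `f` is a smooth map whose differential is injective at every point. -/
def IsSmoothImmersion {k : ℕ} (f : M → E k) : Prop :=
  ContMDiff (𝓡 n) 𝓘(ℝ, E k) ∞ f ∧ ∀ p : M, Function.Injective (differential (n := n) f p)

/-- The inverse of the preferred chart at `p`: a local parametrization of `M` around `p`. -/
noncomputable def param (n : ℕ) {M : Type*} [TopologicalSpace M] [ChartedSpace (E n) M]
    (p : M) : E n → M := (extChartAt (𝓡 n) p).symm

/-- The coordinates of `p` in the preferred chart at `p`. -/
noncomputable def coord (n : ℕ) {M : Type*} [TopologicalSpace M] [ChartedSpace (E n) M]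
    (p : M) : E n := extChartAt (𝓡 n) p p

/-- `∂ᵢ f` on the coordinate space. -/
noncomputable def pd {F : Type*} [NormedAddCommGroup F] [NormedSpace ℝ F]
    (i : Fin n) (f : E n → F) (u : E n) : F := fderiv ℝ f u (e i)

/-- The coordinate vector field `∂ᵢ` of the preferred chart at `p`, at the point of `M` with
coordinates `u`. -/
noncomputable def coordField (p : M) (i : Fin n) (u : E n) :
    TangentSpace (𝓡 n) (param n p u) :=
  mfderiv 𝓘(ℝ, E n) (𝓡 n) (param n p) u (e i)

variable [IsManifold (𝓡 n) ∞ M]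

/-- The matrix `gᵢⱼ = g(∂ᵢ, ∂ⱼ)` in the preferred chart at `p`, as a function of the
coordinates `u`. -/
noncomputable def gram (g : Metric n M) (p : M) (u : E n) : Matrix (Fin n) (Fin n) ℝ :=
  Matrix.of fun i j => g.inner (param n p u) (coordField p i u) (coordField p j u)

/-- The Christoffel symbols `Γᵏᵢⱼ` of the Levi-Civita connection of `g`, in the preferred chart
at `p`. -/
noncomputable def christoffel (g : Metric n M) (p : M) (k i j : Fin n) (u : E n) : ℝ :=
  (1 / 2) * ∑ l, (gram g p u)⁻¹ k l *
    (pd i (fun w => gram g p w j l) u + pd j (fun w => gram g p w i l) u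
      - pd l (fun w => gram g p w i j) u)

/-- The Laplace operator `Δ f = - trace ∇² f` of the Riemannian manifold `(M, g)`, applied
componentwise to a vector-valued function: at `p`, in the chart at `p`,
`Δ f = - ∑ᵢⱼ gⁱʲ (∂ᵢ∂ⱼ f - ∑ₖ Γᵏᵢⱼ ∂ₖ f)`. -/
noncomputable def laplacian {F : Type*} [NormedAddCommGroup F] [NormedSpace ℝ F]
    (g : Metric n M) (f : M → F) (p : M) : F :=
  - ∑ i, ∑ j, (gram g p (coord n p))⁻¹ i j •
    (pd i (pd j (f ∘ param n p)) (coord n p)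
      - ∑ k, christoffel g p k i j (coord n p) • pd k (f ∘ param n p) (coord n p))

/-- `x` is an isometric immersion of the Riemannian manifold `(M, g)` into Euclidean space.
(Injectivity of the differential follows from positivity of `g`.) -/
def IsIsometricImmersion {m : ℕ} (g : Metric n M) (x : M → E m) : Prop :=
  ContMDiff (𝓡 n) 𝓘(ℝ, E m) ∞ x ∧
    ∀ (p : M) (v w : TangentSpace (𝓡 n) p),
      inner ℝ (differential (n := n) x p v) (differential (n := n) x p w) = g.inner p v w

/-- The Laplace map `L = Δ x` of `x`. -/
noncomputable def laplaceMap {m : ℕ} (g : Metric n M) (x : M → E m) : M → E m :=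
  fun p => laplacian g x p

/-- The second fundamental form `h(∂ᵢ, ∂ⱼ)` of `x` at `p`: by the Gauss formula, the component of
`∂ᵢ∂ⱼ x` normal to the submanifold. -/
noncomputable def secondFF {m : ℕ} (x : M → E m) (p : M) (i j : Fin n) : E m :=
  ((LinearMap.range (differential (n := n) x p).toLinearMap)ᗮ).starProjection
    (pd i (pd j (x ∘ param n p)) (coord n p))

/-- The mean curvature vector `H = (1/n) trace h`. -/
noncomputable def meanCurvatureVector {m : ℕ} (g : Metric n M) (x : M → E m) (p : M) : E m :=
  (1 / (n : ℝ)) • ∑ i, ∑ j, (gram g p (coord n p))⁻¹ i j • secondFF x p i j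

/-- The mean curvature function `α = ‖H‖`. -/
noncomputable def meanCurvature {m : ℕ} (g : Metric n M) (x : M → E m) (p : M) : ℝ :=
  ‖meanCurvatureVector g x p‖

end Manifold

section Hypersurface

variable {n : ℕ} {M : Type*} [TopologicalSpace M] [ChartedSpace (E n) M]

/-- `G` is a Gauss map of the hypersurface `x : M → E (n + 1)`: a smooth unit normal field. The
Grassmannian of oriented lines of `E (n + 1)` is its unit sphere, and since `E (n + 1)` is
oriented, an orientation of `M` amounts to the choice of such a field. -/
def IsGaussMap (x G : M → E (n + 1)) : Prop :=
  ContMDiff (𝓡 n) 𝓘(ℝ, E (n + 1)) ∞ G ∧ (∀ p, ‖G p‖ = 1) ∧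
    ∀ (p : M) (v : TangentSpace (𝓡 n) p), inner ℝ (G p) (differential (n := n) x p v) = 0

/-- `f` represents the Laplace-Gauss transformation `L(U) → G(U)`, `L(q) ↦ G(q)`, over the open
set `U`, on which the Laplace map `L` is one-to-one. Only the values of `f` on `L(U)` matter. -/
def IsLGTransformation {m : ℕ} (L G : M → E m) (U : Set M) (f : E m → E m) : Prop :=
  IsOpen U ∧ Set.InjOn L U ∧ ∀ q ∈ U, f (L q) = G q

/-- Let `L` be an immersion which is one-to-one on the open set `U`, so that `L(U)` is a
submanifold with the smooth structure carried over from `U` and with the induced metric. The map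
`f` on `L(U)` is weakly conformal: for some function `ρ ≥ 0` on `L(U)`,
`⟨df(X), df(Y)⟩ = ρ² ⟨X, Y⟩` for all vectors `X, Y` tangent to `L(U)`. The tangent vectors at
`L(q)` are the vectors `X = dL(v)`, and `df(dL(v)) = d(f ∘ L)(v)`. -/
def IsWeaklyConformalOnImage {m : ℕ} (L : M → E m) (U : Set M) (f : E m → E m) : Prop :=
  ∃ ρ : E m → ℝ, (∀ y ∈ L '' U, 0 ≤ ρ y) ∧
    ∀ q ∈ U, ∀ v w : TangentSpace (𝓡 n) q,
      inner ℝ (differential (n := n) (f ∘ L) q v) (differential (n := n) (f ∘ L) q w) =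
        ρ (L q) ^ 2 * inner ℝ (differential (n := n) L q v) (differential (n := n) L q w)

/-- The (locally defined) Laplace-Gauss transformation is weakly conformal: around every point of
`M` it exists and is weakly conformal. -/
def LGWeaklyConformal {m : ℕ} (L G : M → E m) : Prop :=
  ∀ p : M, ∃ (U : Set M) (f : E m → E m), p ∈ U ∧ IsLGTransformation L G U f ∧
    IsWeaklyConformalOnImage (n := n) L U f

/-- Around `p` the hypersurface `x` is a product of a planar curve and an affine `(n-1)`-space:
there are an `(n-1)`-dimensional linear subspace `V`, a regular smooth curve `γ` in the orthogonal
plane `Vᗮ`, and a diffeomorphism `Φ` from a neighbourhood of `p` onto a product of an open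
interval and an open subset of `V`, which turns `x` into `(t, v) ↦ γ(t) + v`. -/
def IsCurveProductNear (x : M → E (n + 1)) (p : M) : Prop :=
  ∃ (V : Submodule ℝ (E (n + 1))) (a b : ℝ) (W : Set V) (γ : ℝ → E (n + 1))
    (Φ : PartialDiffeomorph (𝓡 n) 𝓘(ℝ, ℝ × V) M (ℝ × V) ∞),
    Module.finrank ℝ V + 1 = n ∧
    ContDiffOn ℝ ∞ γ (Set.Ioo a b) ∧
    (∀ t ∈ Set.Ioo a b, γ t ∈ Vᗮ ∧ deriv γ t ≠ 0) ∧
    p ∈ Φ.source ∧ Φ.target = Set.Ioo a b ×ˢ W ∧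
    ∀ q ∈ Φ.source, x q = γ (Φ q).1 + ((Φ q).2 : E (n + 1))

/-- The mean curvature function of `x` is constant on a neighbourhood of `p`. -/
def HasConstantMeanCurvatureNear [IsManifold (𝓡 n) ∞ M] {m : ℕ} (g : Metric n M) (x : M → E m)
    (p : M) : Prop :=
  ∃ U : Set M, IsOpen U ∧ p ∈ U ∧ ∃ c : ℝ, ∀ q ∈ U, meanCurvature g x q = c

end Hypersurface

end LaplaceGauss

namespace LaplaceGauss

/-! ### Coordinate derivatives in inner product spaces, Gauss formula, Gram matrices. -/

section Euclidean

open Filter Topology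

variable {n : ℕ} {F : Type*} [NormedAddCommGroup F]

/-! By the Gauss formula the covariant Hessian of $x$ is normal, so $L=\Delta x=-nH$ is normal and
$L=\lambda G$ with $\lambda=\langle G,L\rangle$, $\alpha=|\lambda|/n$. Hence
$dL=\lambda\,dG+d\lambda\,G$, an orthogonal splitting because $|G|=1$ (`differential_laplaceMap`,
`inner_differential`).

If $LG$ is weakly conformal, then $|dG(v)|^2=\rho^2(\lambda^2|dG(v)|^2+d\lambda(v)^2)$. As $n\ge 2$,
some $v\ne 0$ has $d\lambda(v)=0$; there $dL(v)=\lambda\,dG(v)\ne 0$ forces $\rho^2\lambda^2=1$, and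
then $d\lambda=0$ on every vector (`differential_laplaceFactor_eq_zero`). So $\lambda$, and with it
$\alpha$, is locally constant.

Conversely, if $\alpha$ is locally constant then so is $\lambda$, which is continuous and never
zero, and $G=\lambda^{-1}L$ makes $LG$ a homothety. The product case cannot occur: there $L$ depends
on the curve parameter alone and is not injective along the affine factor of dimension $n-1\ge 1$
(`not_isCurveProductNear`). -/

theorem pd_pd [NormedSpace ℝ F] {y : E n → F} {u : E n} (hy : ContDiffAt ℝ 2 y u) (i j : Fin n) :
    pd i (pd j y) u = fderiv ℝ (fderiv ℝ y) u (e i) (e j) := by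
  have h : DifferentiableAt ℝ (fderiv ℝ y) u :=
    (hy.fderiv_right (m := 1) (by norm_num)).differentiableAt (by norm_num)
  have := fderiv_clm_apply h (differentiableAt_const (c := (e j : E n)))
  change fderiv ℝ (fun w => fderiv ℝ y w (e j)) u (e i) = _
  rw [this]
  simp

theorem pd_pd_comm [NormedSpace ℝ F] {y : E n → F} {u : E n} (hy : ContDiffAt ℝ 2 y u)
    (i j : Fin n) : pd i (pd j y) u = pd j (pd i y) u := by
  rw [pd_pd hy, pd_pd hy]
  exact (hy.isSymmSndFDerivAt (by simp)).eq _ _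

theorem differentiableAt_pd [NormedSpace ℝ F] {y : E n → F} {u : E n} (hy : ContDiffAt ℝ 2 y u)
    (i : Fin n) : DifferentiableAt ℝ (pd i y) u :=
  ((hy.fderiv_right (m := 1) (by norm_num)).differentiableAt (by norm_num)).clm_apply
    (differentiableAt_const _)

variable [InnerProductSpace ℝ F]

theorem pd_inner {y z : E n → F} {u : E n} (hy : DifferentiableAt ℝ y u)
    (hz : DifferentiableAt ℝ z u) (i : Fin n) :
    pd i (fun w => inner ℝ (y w) (z w)) u =
      inner ℝ (pd i y u) (z u) + inner ℝ (y u) (pd i z u) := by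
  unfold pd
  rw [fderiv_inner_apply ℝ hy hz, add_comm]

/-- The Gauss formula: the covariant Hessian of a parametrized submanifold is normal. -/
theorem inner_covariant_hessian_pd {y : E n → F} {u : E n} (hy : ContDiffAt ℝ 2 y u)
    {A : E n → Matrix (Fin n) (Fin n) ℝ}
    (hA : ∀ᶠ w in 𝓝 u, ∀ i j, A w i j = inner ℝ (pd i y w) (pd j y w))
    (hdet : IsUnit (A u).det) (i j l : Fin n) :
    inner ℝ (pd i (pd j y) u - ∑ k, ((1 / 2 : ℝ) * ∑ m, (A u)⁻¹ k m *
      (pd i (fun w => A w j m) u + pd j (fun w => A w i m) u - pd m (fun w => A w i j) u)) •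
        pd k y u) (pd l y u) = 0 := by
  have hd (a b c : Fin n) : pd a (fun w => A w b c) u =
      inner ℝ (pd a (pd b y) u) (pd c y u) + inner ℝ (pd b y u) (pd a (pd c y) u) := by
    rw [← pd_inner (differentiableAt_pd hy b) (differentiableAt_pd hy c)]
    unfold pd
    rw [Filter.EventuallyEq.fderiv_eq]
    filter_upwards [hA] with w hw
    exact hw b c
  -- The Koszul combination: symmetry of second derivatives cancels all terms but one pair.
  have hbr (m : Fin n) : pd i (fun w => A w j m) u + pd j (fun w => A w i m) u
      - pd m (fun w => A w i j) u = 2 * inner ℝ (pd i (pd j y) u) (pd m y u) := by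
    rw [hd, hd, hd, pd_pd_comm hy j i, pd_pd_comm hy m i, pd_pd_comm hy m j,
      real_inner_comm (pd j y u) (pd i (pd m y) u)]
    ring
  have hAu := hA.self_of_nhds
  have key (m : Fin n) : ∑ k, (A u)⁻¹ k m * inner ℝ (pd k y u) (pd l y u) =
      (1 : Matrix (Fin n) (Fin n) ℝ) l m := by
    rw [← Matrix.mul_nonsing_inv _ hdet, Matrix.mul_apply]
    refine Finset.sum_congr rfl fun k _ => ?_
    rw [hAu, real_inner_comm, mul_comm]
  simp only [hbr, inner_sub_left, sum_inner, real_inner_smul_left]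
  have : ∀ k, (1 / 2 : ℝ) * ∑ m, (A u)⁻¹ k m * (2 * inner ℝ (pd i (pd j y) u) (pd m y u)) =
      ∑ m, (A u)⁻¹ k m * inner ℝ (pd i (pd j y) u) (pd m y u) := fun k => by
    rw [Finset.mul_sum]
    exact Finset.sum_congr rfl fun m _ => by ring
  simp only [this, Finset.sum_mul]
  rw [Finset.sum_comm, sub_eq_zero]
  have h2 (m : Fin n) : ∑ k, (A u)⁻¹ k m * inner ℝ (pd i (pd j y) u) (pd m y u) *
      inner ℝ (pd k y u) (pd l y u) =
      (1 : Matrix (Fin n) (Fin n) ℝ) l m * inner ℝ (pd i (pd j y) u) (pd m y u) := by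
    rw [← key, Finset.sum_mul]
    exact Finset.sum_congr rfl fun k _ => by ring
  simp [h2, Matrix.one_apply]

/-- If $a=\sum c_k b_k$, the pairings with the $b_j$ form the vector $Ac$, and $A^{-1}$ recovers
$c$. This later evaluates the trace in the Laplacian of a product. -/
theorem sum_inv_gram_inner {b : Fin n → F} {A : Matrix (Fin n) (Fin n) ℝ}
    (hA : ∀ i j, A i j = inner ℝ (b i) (b j)) (hdet : IsUnit A.det) {a : F}
    (ha : a ∈ Submodule.span ℝ (Set.range b)) :
    ∑ i, ∑ j, A⁻¹ i j * (inner ℝ (b i) a * inner ℝ (b j) a) = inner ℝ a a := by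
  obtain ⟨c, hc⟩ := (Submodule.mem_span_range_iff_exists_fun ℝ).1 ha
  have h1 (j : Fin n) : inner ℝ (b j) a = A.mulVec c j := by
    simp [← hc, inner_sum, real_inner_smul_right, Matrix.mulVec, dotProduct, hA, mul_comm]
  have h2 (i : Fin n) : ∑ j, A⁻¹ i j * inner ℝ (b j) a = c i := by
    have : A⁻¹.mulVec (A.mulVec c) i = c i := by
      rw [Matrix.mulVec_mulVec, Matrix.nonsing_inv_mul _ hdet, Matrix.one_mulVec]
    simp only [h1]
    exact this
  calc ∑ i, ∑ j, A⁻¹ i j * (inner ℝ (b i) a * inner ℝ (b j) a)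
      = ∑ i, (∑ j, A⁻¹ i j * inner ℝ (b j) a) * inner ℝ (b i) a := by
        refine Finset.sum_congr rfl fun i _ => ?_
        rw [Finset.sum_mul]
        exact Finset.sum_congr rfl fun j _ => by ring
    _ = ∑ i, c i * inner ℝ (b i) a := by simp only [h2]
    _ = inner ℝ a a := by
        nth_rewrite 2 [← hc]
        simp only [sum_inner, real_inner_smul_left]

end Euclidean

/-! ### Differentials in the preferred charts. -/

section Chart

variable {n : ℕ} {M : Type*} [TopologicalSpace M] [ChartedSpace (E n) M]
  {F : Type*} [NormedAddCommGroup F] [NormedSpace ℝ F]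

theorem differential_apply {f : M → F} {p : M} (hf : MDifferentiableAt (𝓡 n) 𝓘(ℝ, F) f p)
    (v : E n) : differential (n := n) f p v = fderiv ℝ (f ∘ param n p) (coord n p) v := by
  unfold differential
  rw [hf.mfderiv]
  simp [param, coord, writtenInExtChartAt]
  rfl

theorem coord_mem_target (p : M) : coord n p ∈ (extChartAt (𝓡 n) p).target :=
  mem_extChartAt_target p

theorem target_mem_nhds (p : M) : (extChartAt (𝓡 n) p).target ∈ nhds (coord n p) :=
  (isOpen_extChartAt_target p).mem_nhds (coord_mem_target p)

@[simp]
theorem param_coord (p : M) : param n p (coord n p) = p :=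
  extChartAt_to_inv p

theorem e_eq_basis : (fun i : Fin n => (e i : E n)) =
    (EuclideanSpace.basisFun (Fin n) ℝ).toBasis := by
  funext i
  simp

theorem pd_comp_param_coord {f : M → F}
    {p : M} (hf : MDifferentiableAt (𝓡 n) 𝓘(ℝ, F) f p) (i : Fin n) :
    pd i (f ∘ param n p) (coord n p) = differential (n := n) f p (e i : E n) :=
  (differential_apply hf _).symm

theorem range_differential {f : M → F}
    {p : M} (hf : MDifferentiableAt (𝓡 n) 𝓘(ℝ, F) f p) :
    LinearMap.range (differential (n := n) f p).toLinearMap =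
      Submodule.span ℝ (Set.range fun i => pd i (f ∘ param n p) (coord n p)) := by
  let φ : E n →ₗ[ℝ] F := (differential (n := n) f p).toLinearMap
  have hb : Submodule.span ℝ (Set.range fun i : Fin n => (e i : E n)) = ⊤ := by
    rw [e_eq_basis, Module.Basis.span_eq]
  change LinearMap.range φ = _
  rw [LinearMap.range_eq_map, ← hb, Submodule.map_span, ← Set.range_comp]
  congr 2
  funext i
  exact (pd_comp_param_coord hf i).symm

/-- A linear functional on a space of dimension at least two has a nontrivial kernel; this is how
$n\ge 2$ enters the conformality argument. -/
theorem exists_ne_zero_differential_eq_zero (hn : 2 ≤ n) (f : M → ℝ) (p : M) :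
    ∃ v : E n, v ≠ 0 ∧ differential (n := n) f p v = 0 := by
  let φ : E n →ₗ[ℝ] ℝ := (differential (n := n) f p).toLinearMap
  have h : LinearMap.ker φ ≠ ⊥ := LinearMap.ker_ne_bot_of_finrank_lt (by simpa using Nat.lt_of_succ_le hn)
  obtain ⟨v, hv, hv0⟩ := Submodule.exists_mem_ne_zero_of_ne_bot h
  exact ⟨v, hv0, hv⟩

variable [IsManifold (𝓡 n) ∞ M]

theorem contMDiffAt_param (p : M) {u : E n} (hu : u ∈ (extChartAt (𝓡 n) p).target) :
    ContMDiffAt 𝓘(ℝ, E n) (𝓡 n) ∞ (param n p) u :=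
  (contMDiffOn_extChartAt_symm p).contMDiffAt ((isOpen_extChartAt_target p).mem_nhds hu)

theorem contDiffAt_comp_param {f : M → F} {p : M} {u : E n}
    (hu : u ∈ (extChartAt (𝓡 n) p).target)
    (hf : ContMDiffAt (𝓡 n) 𝓘(ℝ, F) ∞ f (param n p u)) :
    ContDiffAt ℝ ∞ (f ∘ param n p) u :=
  contMDiffAt_iff_contDiffAt.1 (hf.comp u (contMDiffAt_param p hu))

theorem pd_comp_param {f : M → F} (p : M) {u : E n} (hu : u ∈ (extChartAt (𝓡 n) p).target)
    (hf : MDifferentiableAt (𝓡 n) 𝓘(ℝ, F) f (param n p u)) (i : Fin n) :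
    pd i (f ∘ param n p) u = differential (n := n) f (param n p u) (coordField p i u) := by
  unfold pd differential coordField
  rw [← mfderiv_eq_fderiv, mfderiv_comp u hf ((contMDiffAt_param p hu).mdifferentiableAt (by simp))]
  rfl

end Chart

/-! ### Isometric immersions: normality of the Laplace map and mean curvature. -/

section Immersion

variable {n m : ℕ} {M : Type*} [TopologicalSpace M] [ChartedSpace (E n) M]
  [IsManifold (𝓡 n) ∞ M] {g : Metric n M} {x : M → E m}

theorem IsIsometricImmersion.mdifferentiable (hx : IsIsometricImmersion g x) (p : M) :
    MDifferentiableAt (𝓡 n) 𝓘(ℝ, E m) x p :=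
  hx.1.mdifferentiableAt (by simp)

theorem IsIsometricImmersion.contDiffAt (hx : IsIsometricImmersion g x) (p : M) {u : E n}
    (hu : u ∈ (extChartAt (𝓡 n) p).target) : ContDiffAt ℝ ∞ (x ∘ param n p) u :=
  contDiffAt_comp_param hu (hx.1 _)

theorem IsIsometricImmersion.gram_apply (hx : IsIsometricImmersion g x) (p : M) {u : E n}
    (hu : u ∈ (extChartAt (𝓡 n) p).target) (i j : Fin n) :
    gram g p u i j = inner ℝ (pd i (x ∘ param n p) u) (pd j (x ∘ param n p) u) := by
  rw [pd_comp_param p hu (hx.mdifferentiable _), pd_comp_param p hu (hx.mdifferentiable _), hx.2]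
  rfl

theorem IsIsometricImmersion.injective_differential (hx : IsIsometricImmersion g x) (p : M) :
    Function.Injective (differential (n := n) x p) := by
  rw [injective_iff_map_eq_zero]
  intro v hv
  by_contra h
  have h1 := g.pos p v h
  rw [← hx.2, hv, inner_zero_left] at h1
  exact lt_irrefl _ h1

theorem IsIsometricImmersion.linearIndependent_pd (hx : IsIsometricImmersion g x) (p : M) :
    LinearIndependent ℝ fun i => pd i (x ∘ param n p) (coord n p) := by
  let φ : E n →ₗ[ℝ] E m := (differential (n := n) x p).toLinearMap
  have hφ : Function.Injective φ := hx.injective_differential p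
  have hli : LinearIndependent ℝ fun i : Fin n => (e i : E n) := by
    rw [e_eq_basis]
    exact Module.Basis.linearIndependent _
  have h : (fun i => pd i (x ∘ param n p) (coord n p)) = φ ∘ fun i : Fin n => (e i : E n) :=
    funext fun i => pd_comp_param_coord (hx.mdifferentiable p) i
  rw [h]
  exact hli.map' φ (LinearMap.ker_eq_bot.2 hφ)

theorem IsIsometricImmersion.isUnit_det_gram (hx : IsIsometricImmersion g x) (p : M) :
    IsUnit (gram g p (coord n p)).det := by
  have h : gram g p (coord n p) =
      Matrix.gram ℝ fun i => pd i (x ∘ param n p) (coord n p) := by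
    ext i j
    rw [hx.gram_apply p (coord_mem_target p), Matrix.gram_apply]
  rw [h, isUnit_iff_ne_zero, Matrix.det_gram_ne_zero_iff_linearIndependent]
  exact hx.linearIndependent_pd p

theorem IsIsometricImmersion.covariant_hessian_mem_orthogonal (hx : IsIsometricImmersion g x)
    (p : M) (i j : Fin n) :
    pd i (pd j (x ∘ param n p)) (coord n p)
      - ∑ k, christoffel g p k i j (coord n p) • pd k (x ∘ param n p) (coord n p) ∈
      (LinearMap.range (differential (n := n) x p).toLinearMap)ᗮ := by
  rw [range_differential (hx.mdifferentiable p), Submodule.mem_orthogonal']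
  intro w hw
  refine Submodule.span_induction (p := fun w _ => inner ℝ _ w = 0) ?_ (inner_zero_right _)
    (fun a b _ _ ha hb => by rw [inner_add_right, ha, hb, add_zero])
    (fun c a _ ha => by rw [inner_smul_right, ha, mul_zero]) hw
  rintro _ ⟨l, rfl⟩
  refine inner_covariant_hessian_pd ((hx.contDiffAt p (coord_mem_target p)).of_le
    (WithTop.coe_le_coe.2 le_top : ((2 : ℕ∞) : WithTop ℕ∞) ≤ ∞)) ?_ (hx.isUnit_det_gram p) i j l
  filter_upwards [target_mem_nhds p] with w hw i j using hx.gram_apply p hw i j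

theorem IsIsometricImmersion.laplaceMap_mem_orthogonal (hx : IsIsometricImmersion g x) (p : M) :
    laplaceMap g x p ∈ (LinearMap.range (differential (n := n) x p).toLinearMap)ᗮ :=
  Submodule.neg_mem _ <| Submodule.sum_mem _ fun i _ => Submodule.sum_mem _ fun j _ =>
    Submodule.smul_mem _ _ (hx.covariant_hessian_mem_orthogonal p i j)

/-- The Gauss formula. -/
theorem IsIsometricImmersion.secondFF_eq (hx : IsIsometricImmersion g x) (p : M) (i j : Fin n) :
    secondFF x p i j = pd i (pd j (x ∘ param n p)) (coord n p)
      - ∑ k, christoffel g p k i j (coord n p) • pd k (x ∘ param n p) (coord n p) := by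
  refine Submodule.eq_starProjection_of_mem_orthogonal
    (hx.covariant_hessian_mem_orthogonal p i j) ?_
  rw [sub_sub_cancel, Submodule.orthogonal_orthogonal,
    range_differential (hx.mdifferentiable p)]
  exact Submodule.sum_mem _ fun k _ => Submodule.smul_mem _ _ (Submodule.subset_span ⟨k, rfl⟩)

/-- The second fundamental form is the covariant Hessian of $x$, so both sides are multiples of the
same trace. -/
theorem IsIsometricImmersion.meanCurvatureVector_eq (hx : IsIsometricImmersion g x) (p : M) :
    meanCurvatureVector g x p = -(1 / (n : ℝ)) • laplaceMap g x p := by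
  simp only [meanCurvatureVector, laplaceMap, laplacian, hx.secondFF_eq, neg_smul, smul_neg,
    neg_neg]

theorem IsIsometricImmersion.meanCurvature_eq (hx : IsIsometricImmersion g x) (p : M) :
    meanCurvature g x p = ‖laplaceMap g x p‖ / n := by
  rw [meanCurvature, hx.meanCurvatureVector_eq, norm_smul, norm_neg, norm_div, norm_one,
    RCLike.norm_natCast]
  ring

/-- An immersion into a Euclidean space is locally injective. -/
theorem IsSmoothImmersion.exists_injOn {f : M → E m} (hf : IsSmoothImmersion (n := n) f) (p : M) :
    ∃ U : Set M, IsOpen U ∧ p ∈ U ∧ Set.InjOn f U := by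
  have hd : MDifferentiableAt (𝓡 n) 𝓘(ℝ, E m) f p := hf.1.mdifferentiableAt (by simp)
  set φ : E n →L[ℝ] E m := fderiv ℝ (f ∘ param n p) (coord n p) with hφ
  have hinj : Function.Injective φ := fun v w h =>
    hf.2 p ((differential_apply hd v).trans (h.trans (differential_apply hd w).symm))
  obtain ⟨ψ, hψ⟩ := (φ : E n →ₗ[ℝ] E m).exists_leftInverse_of_injective
    (LinearMap.ker_eq_bot.2 hinj)
  have hstrict : HasStrictFDerivAt (f ∘ param n p) φ (coord n p) :=
    (contDiffAt_comp_param (coord_mem_target p) (hf.1 _)).hasStrictFDerivAt (by simp)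
  -- Composed with a left inverse of its differential, $f$ has derivative the identity, so the
  -- inverse function theorem gives local injectivity.
  have hcomp : HasStrictFDerivAt (fun u => ψ.toContinuousLinearMap ((f ∘ param n p) u))
      (ContinuousLinearEquiv.refl ℝ (E n) : E n →L[ℝ] E n) (coord n p) := by
    have hid : ((ContinuousLinearEquiv.refl ℝ (E n) : E n ≃L[ℝ] E n) : E n →L[ℝ] E n) =
        ψ.toContinuousLinearMap ∘L φ :=
      ContinuousLinearMap.ext fun v => (LinearMap.congr_fun hψ v).symm
    rw [hid]
    exact ψ.toContinuousLinearMap.hasStrictFDerivAt.comp (coord n p) hstrict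
  set h := hcomp.toOpenPartialHomeomorph _ with hh
  refine ⟨(extChartAt (𝓡 n) p).source ∩ extChartAt (𝓡 n) p ⁻¹' h.source,
    (continuousOn_extChartAt p).isOpen_inter_preimage (isOpen_extChartAt_source p) h.open_source,
    ⟨mem_extChartAt_source p, hcomp.mem_toOpenPartialHomeomorph_source⟩, ?_⟩
  intro a ha b hb hab
  refine (extChartAt (𝓡 n) p).injOn ha.1 hb.1 (h.injOn ha.2 hb.2 ?_)
  change ψ (f ((extChartAt (𝓡 n) p).symm _)) = ψ (f ((extChartAt (𝓡 n) p).symm _))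
  rw [(extChartAt (𝓡 n) p).left_inv ha.1, (extChartAt (𝓡 n) p).left_inv hb.1, hab]

end Immersion

/-! ### Codimension one: the Laplace map is a multiple of the Gauss map. -/

section Hypersurface

variable {n : ℕ} {M : Type*} [TopologicalSpace M] [ChartedSpace (E n) M]
  [IsManifold (𝓡 n) ∞ M] {g : Metric n M} {x G : M → E (n + 1)}

/-- The tangent space has dimension $n$ in $\mathbb E^{n+1}$, so the normal space is a line, spanned
by the unit vector $G$. -/
theorem IsIsometricImmersion.laplaceMap_eq (hx : IsIsometricImmersion g x)
    (hG : IsGaussMap (n := n) x G) (p : M) :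
    laplaceMap g x p = (inner ℝ (G p) (laplaceMap g x p) : ℝ) • G p := by
  set R := LinearMap.range (differential (n := n) x p).toLinearMap with hR
  have hGR : G p ∈ Rᗮ := by
    rw [Submodule.mem_orthogonal']
    rintro _ ⟨v, rfl⟩
    exact hG.2.2 p v
  have hG0 : G p ≠ 0 := fun h => by simpa [h] using hG.2.1 p
  have hfin : Module.finrank ℝ Rᗮ = 1 := by
    have h1 : Module.finrank ℝ R = n := by
      rw [hR, range_differential (hx.mdifferentiable p),
        finrank_span_eq_card (hx.linearIndependent_pd p), Fintype.card_fin]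
    have h2 := R.finrank_add_finrank_orthogonal
    rw [h1, finrank_euclideanSpace, Fintype.card_fin] at h2
    omega
  obtain ⟨c, hc⟩ := (finrank_eq_one_iff_of_nonzero' (⟨G p, hGR⟩ : Rᗮ)
    (by simpa [Subtype.ext_iff] using hG0)).1 hfin ⟨_, hx.laplaceMap_mem_orthogonal p⟩
  have hc' : c • G p = laplaceMap g x p := congrArg Subtype.val hc
  rw [← hc', inner_smul_right, real_inner_self_eq_norm_sq, hG.2.1 p]
  simp

end Hypersurface

/-! ### Weak conformality and constant mean curvature. -/

section Conformal

variable {n : ℕ} {M : Type*} [TopologicalSpace M] [ChartedSpace (E n) M]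
  [IsManifold (𝓡 n) ∞ M] {g : Metric n M} {x G : M → E (n + 1)}

/-- The factor `⟨G, L⟩` in `L = ⟨G, L⟩ G`; it is `-n` times the mean curvature with respect
to the unit normal `G`. -/
noncomputable def laplaceFactor (g : Metric n M) (x G : M → E (n + 1)) (p : M) : ℝ :=
  inner ℝ (G p) (laplaceMap g x p)

theorem contMDiff_laplaceFactor (hG : IsGaussMap (n := n) x G)
    (hL : IsSmoothImmersion (n := n) (laplaceMap g x)) :
    ContMDiff (𝓡 n) 𝓘(ℝ, ℝ) ∞ (laplaceFactor g x G) :=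
  (contDiff_inner (𝕜 := ℝ) (E := E (n + 1))).contMDiff.comp (hG.1.prodMk_space hL.1)

theorem IsIsometricImmersion.meanCurvature_eq_abs (hx : IsIsometricImmersion g x)
    (hG : IsGaussMap (n := n) x G) (p : M) :
    meanCurvature g x p = |laplaceFactor g x G p| / n := by
  rw [hx.meanCurvature_eq, hx.laplaceMap_eq hG, norm_smul, hG.2.1, mul_one, Real.norm_eq_abs,
    laplaceFactor]

theorem IsIsometricImmersion.differential_laplaceMap (hx : IsIsometricImmersion g x)
    (hG : IsGaussMap (n := n) x G) (hL : IsSmoothImmersion (n := n) (laplaceMap g x)) (p : M)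
    (v : E n) :
    differential (n := n) (laplaceMap g x) p v =
      laplaceFactor g x G p • differential (n := n) G p v +
        differential (n := n) (laplaceFactor g x G) p v • G p := by
  have h1 := contMDiff_laplaceFactor hG hL
  rw [differential_apply (hL.1.mdifferentiableAt (by simp)),
    differential_apply (hG.1.mdifferentiableAt (by simp)),
    differential_apply (h1.mdifferentiableAt (by simp))]
  have hfun : laplaceMap g x ∘ param n p =
      (laplaceFactor g x G ∘ param n p) • (G ∘ param n p) :=
    funext fun u => hx.laplaceMap_eq hG _
  rw [hfun, fderiv_smul
    ((contDiffAt_comp_param (coord_mem_target p) (h1 _)).differentiableAt (by simp))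
    ((contDiffAt_comp_param (coord_mem_target p) (hG.1 _)).differentiableAt (by simp))]
  simp

/-- Differentiate $\langle G,G\rangle=1$. -/
theorem IsGaussMap.inner_differential (hG : IsGaussMap (n := n) x G) (p : M) (v : E n) :
    inner ℝ (G p) (differential (n := n) G p v) = 0 := by
  rw [differential_apply (hG.1.mdifferentiableAt (by simp))]
  have hd : DifferentiableAt ℝ (G ∘ param n p) (coord n p) :=
    (contDiffAt_comp_param (coord_mem_target p) (hG.1 _)).differentiableAt (by simp)
  have h := fderiv_inner_apply ℝ hd hd v
  have hone : (fun u => inner ℝ ((G ∘ param n p) u) ((G ∘ param n p) u) : E n → ℝ) =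
      fun _ => 1 := by
    funext u
    rw [real_inner_self_eq_norm_sq, Function.comp_apply, hG.2.1, one_pow]
  rw [hone, real_inner_comm ((G ∘ param n p) (coord n p))] at h
  simp only [fderiv_fun_const, Pi.zero_apply, zero_apply, Function.comp_apply,
    param_coord] at h
  linarith

/-- At a zero of the factor, $dL=d\lambda\,G$ has rank at most one, which is impossible for an
immersion of dimension $n\ge 2$. -/
theorem IsIsometricImmersion.laplaceFactor_ne_zero (hn : 2 ≤ n) (hx : IsIsometricImmersion g x)
    (hG : IsGaussMap (n := n) x G) (hL : IsSmoothImmersion (n := n) (laplaceMap g x)) (p : M) :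
    laplaceFactor g x G p ≠ 0 := by
  intro h0
  obtain ⟨v, hv0, hv⟩ := exists_ne_zero_differential_eq_zero hn (laplaceFactor g x G) p
  refine hv0 (hL.2 p ?_)
  rw [hx.differential_laplaceMap hG hL, hv, h0, zero_smul, zero_smul, add_zero]
  exact (ContinuousLinearMap.map_zero _).symm

/-- If the Laplace-Gauss transformation is weakly conformal, the factor in `L = ⟨G, L⟩ G` is
stationary: along a vector `v ≠ 0` annihilated by its differential, `dL v` is a nonzero multiple
of `dG v`, which determines the conformal factor. -/
theorem IsIsometricImmersion.differential_laplaceFactor_eq_zero (hn : 2 ≤ n)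
    (hx : IsIsometricImmersion g x) (hG : IsGaussMap (n := n) x G)
    (hL : IsSmoothImmersion (n := n) (laplaceMap g x))
    (hLG : LGWeaklyConformal (n := n) (laplaceMap g x) G) (q : M) (w : E n) :
    differential (n := n) (laplaceFactor g x G) q w = 0 := by
  obtain ⟨U, f, hqU, ⟨hU, -, hf⟩, ρ, -, hρ⟩ := hLG q
  have hfG : differential (n := n) (f ∘ laplaceMap g x) q = differential (n := n) G q := by
    refine Filter.EventuallyEq.mfderiv_eq ?_
    filter_upwards [hU.mem_nhds hqU] with q' hq' using hf q' hq'
  -- Conformality on the diagonal, with $|dL(v)|^2$ expanded by Pythagoras.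
  have key (v : E n) : inner ℝ (differential (n := n) G q v) (differential (n := n) G q v) =
      ρ (laplaceMap g x q) ^ 2 * (laplaceFactor g x G q ^ 2 *
        inner ℝ (differential (n := n) G q v) (differential (n := n) G q v) +
        differential (n := n) (laplaceFactor g x G) q v ^ 2) := by
    have h := hρ q hqU v v
    rw [hfG, hx.differential_laplaceMap hG hL] at h
    refine h.trans ?_
    congr 1
    simp only [inner_add_left, inner_add_right, real_inner_smul_left, real_inner_smul_right,
      hG.inner_differential, real_inner_comm (G q), real_inner_self_eq_norm_sq (G q), hG.2.1]
    ring
  obtain ⟨v, hv0, hv⟩ := exists_ne_zero_differential_eq_zero hn (laplaceFactor g x G) q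
  have hGv : differential (n := n) G q v ≠ 0 := by
    intro h
    refine hv0 (hL.2 q ?_)
    rw [hx.differential_laplaceMap hG hL, hv, h, smul_zero, zero_smul, add_zero]
    exact (ContinuousLinearMap.map_zero _).symm
  have hGv' : inner ℝ (differential (n := n) G q v) (differential (n := n) G q v) ≠ (0 : ℝ) :=
    inner_self_ne_zero.2 hGv
  have hone : ρ (laplaceMap g x q) ^ 2 * laplaceFactor g x G q ^ 2 = 1 := by
    have h := key v
    rw [hv] at h
    refine mul_right_cancel₀ hGv' ?_
    rw [one_mul]
    nth_rewrite 2 [h]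
    ring
  have hρ0 : ρ (laplaceMap g x q) ^ 2 ≠ 0 := left_ne_zero_of_mul_eq_one hone
  have h := key w
  rw [mul_add, ← mul_assoc, hone, one_mul, left_eq_add] at h
  exact pow_eq_zero_iff (two_ne_zero) |>.1 ((mul_eq_zero.1 h).resolve_left hρ0)

/-- A smooth function with vanishing differential is locally constant. -/
theorem exists_eq_of_differential_eq_zero {f : M → ℝ} (hf : ContMDiff (𝓡 n) 𝓘(ℝ, ℝ) ∞ f)
    (h : ∀ q (w : E n), differential (n := n) f q w = 0) (p : M) :
    ∃ U : Set M, IsOpen U ∧ p ∈ U ∧ ∀ q ∈ U, f q = f p := by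
  -- A coordinate ball is connected, so vanishing derivative gives constancy on it.
  obtain ⟨r, hr, hball⟩ := Metric.mem_nhds_iff.1 (target_mem_nhds (n := n) p)
  refine ⟨(extChartAt (𝓡 n) p).source ∩ extChartAt (𝓡 n) p ⁻¹' Metric.ball (coord n p) r,
    (continuousOn_extChartAt p).isOpen_inter_preimage (isOpen_extChartAt_source p)
      Metric.isOpen_ball, ⟨mem_extChartAt_source p, Metric.mem_ball_self hr⟩, ?_⟩
  rintro q ⟨hq, hqr⟩
  have hd (u : E n) (hu : u ∈ Metric.ball (coord n p) r) :
      DifferentiableAt ℝ (f ∘ param n p) u :=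
    (contDiffAt_comp_param (hball hu) (hf _)).differentiableAt (by simp)
  have hconst := Metric.isOpen_ball.is_const_of_fderiv_eq_zero (𝕜 := ℝ) (f := f ∘ param n p)
    (convex_ball (coord n p) r).isPreconnected
    (fun u hu => (hd u hu).differentiableWithinAt)
    (fun u hu => by
      ext v
      rw [← mfderiv_eq_fderiv, mfderiv_comp u (hf.mdifferentiableAt (by simp))
        ((contMDiffAt_param p (hball hu)).mdifferentiableAt (by simp))]
      exact h _ _)
    hqr (Metric.mem_ball_self hr)
  rwa [Function.comp_apply, Function.comp_apply, param_coord, param,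
    (extChartAt (𝓡 n) p).left_inv hq] at hconst

theorem IsIsometricImmersion.hasConstantMeanCurvatureNear (hn : 2 ≤ n)
    (hx : IsIsometricImmersion g x) (hG : IsGaussMap (n := n) x G)
    (hL : IsSmoothImmersion (n := n) (laplaceMap g x))
    (hLG : LGWeaklyConformal (n := n) (laplaceMap g x) G) (p : M) :
    HasConstantMeanCurvatureNear g x p := by
  obtain ⟨U, hU, hp, h⟩ := exists_eq_of_differential_eq_zero (contMDiff_laplaceFactor hG hL)
    (hx.differential_laplaceFactor_eq_zero hn hG hL hLG) p
  refine ⟨U, hU, hp, |laplaceFactor g x G p| / n, fun q hq => ?_⟩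
  rw [hx.meanCurvature_eq_abs hG, h q hq]

/-- If the mean curvature is constant, the Laplace-Gauss transformation is a homothety. -/
theorem HasConstantMeanCurvatureNear.exists_isWeaklyConformalOnImage (hn : 2 ≤ n)
    (hx : IsIsometricImmersion g x) (hG : IsGaussMap (n := n) x G)
    (hL : IsSmoothImmersion (n := n) (laplaceMap g x)) {p : M}
    (h : HasConstantMeanCurvatureNear g x p) :
    ∃ (U : Set M) (f : E (n + 1) → E (n + 1)), p ∈ U ∧
      IsLGTransformation (laplaceMap g x) G U f ∧
      IsWeaklyConformalOnImage (n := n) (laplaceMap g x) U f := by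
  obtain ⟨U, hU, hpU, c, hc⟩ := h
  obtain ⟨U', hU', hpU', hinj⟩ := hL.exists_injOn p
  have hcont := (contMDiff_laplaceFactor hG hL).continuous
  set l := laplaceFactor g x G with hl
  have hlp : l p ≠ 0 := hx.laplaceFactor_ne_zero hn hG hL p
  have hn0 : (n : ℝ) ≠ 0 := by positivity
  -- Constant $\alpha$ controls only $|\lambda|$; the last condition fixes the sign.
  set N := U ∩ U' ∩ {q | 0 < l q * l p} with hN
  have hlN : ∀ q ∈ N, l q = l p := by
    rintro q ⟨⟨hqU, -⟩, hq : 0 < l q * l p⟩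
    have habs : |l q| = |l p| := by
      have := (hc q hqU).trans (hc p hpU).symm
      rwa [hx.meanCurvature_eq_abs hG, hx.meanCurvature_eq_abs hG, div_left_inj' hn0] at this
    rcases abs_eq_abs.1 habs with h | h
    · exact h
    · rw [h] at hq
      nlinarith [sq_nonneg (l p)]
  refine ⟨N, fun y => (l p)⁻¹ • y, ⟨⟨hpU, hpU'⟩, mul_self_pos.2 hlp⟩,
    ⟨(hU.inter hU').inter (isOpen_lt continuous_const (hcont.mul continuous_const)),
      hinj.mono fun q hq => hq.1.2, fun q hq => ?_⟩, fun _ => |(l p)⁻¹|,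
    fun _ _ => abs_nonneg _, fun q _ v w => ?_⟩
  · change (l p)⁻¹ • laplaceMap g x q = G q
    rw [hx.laplaceMap_eq hG, ← laplaceFactor, ← hl, hlN q hq, inv_smul_smul₀ hlp]
  · have hd (z : TangentSpace (𝓡 n) q) : differential (n := n) ((fun y => (l p)⁻¹ • y) ∘ laplaceMap g x) q z =
        (l p)⁻¹ • differential (n := n) (laplaceMap g x) q z := by
      have hLq : MDifferentiableAt (𝓡 n) 𝓘(ℝ, E (n + 1)) (laplaceMap g x) q :=
        hL.1.mdifferentiableAt (by simp)
      change mfderiv (𝓡 n) 𝓘(ℝ, E (n + 1)) ((l p)⁻¹ • laplaceMap g x) q z = _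
      rw [const_smul_mfderiv hLq]
      rfl
    rw [hd, hd, real_inner_smul_left, real_inner_smul_right, sq_abs]
    ring

end Conformal

/-! ### Products of a planar curve and an affine space. -/

section CurveProduct

open Filter Topology

variable {n : ℕ} {F : Type*} [NormedAddCommGroup F] [InnerProductSpace ℝ F]

theorem pd_inner_const {y : E n → F} {u : E n} (hy : DifferentiableAt ℝ y u) (ν : F) (i : Fin n) :
    pd i (fun w => inner ℝ ν (y w)) u = inner ℝ ν (pd i y u) := by
  rw [pd_inner (differentiableAt_const ν) hy]
  simp [pd]

theorem hasFDerivAt_comp_curve {X : Type*} [NormedAddCommGroup X] [NormedSpace ℝ X] {T : X → ℝ}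
    {T' : X →L[ℝ] ℝ} {γ : ℝ → F} {γ' : F} {u : X} (hγ : HasDerivAt γ γ' (T u))
    (hT : HasFDerivAt T T' u) : HasFDerivAt (fun w => γ (T w)) (T'.smulRight γ') u := by
  have h : T'.smulRight γ' = ContinuousLinearMap.toSpanSingleton ℝ γ' ∘L T' := by
    refine ContinuousLinearMap.ext fun w => ?_
    simp
  rw [h]
  exact hγ.hasFDerivAt.comp u hT

theorem pd_inner_comp {T : E n → ℝ} {γ : ℝ → F} {u : E n} (hT : DifferentiableAt ℝ T u)
    (hγ : DifferentiableAt ℝ γ (T u)) (ν : F) (i : Fin n) :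
    pd i (fun w => inner ℝ ν (γ (T w))) u = pd i T u * inner ℝ ν (deriv γ (T u)) := by
  rw [pd_inner_const (y := fun w => γ (T w)) (hγ.comp u hT)]
  have h : HasFDerivAt (fun w => γ (T w)) ((fderiv ℝ T u).smulRight (deriv γ (T u))) u :=
    hasFDerivAt_comp_curve hγ.hasDerivAt hT.hasFDerivAt
  unfold pd
  rw [h.fderiv, ContinuousLinearMap.smulRight_apply, inner_smul_right]

theorem inner_pd_of_eventually {y : E n → F} {T : E n → ℝ} {γ : ℝ → F} {u : E n} {ν : F}
    (hy : DifferentiableAt ℝ y u) (hT : DifferentiableAt ℝ T u)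
    (hγ : DifferentiableAt ℝ γ (T u))
    (h : ∀ᶠ w in 𝓝 u, inner ℝ ν (y w) = (inner ℝ ν (γ (T w)) : ℝ)) (i : Fin n) :
    inner ℝ ν (pd i y u) = pd i T u * inner ℝ ν (deriv γ (T u)) := by
  rw [← pd_inner_const hy, ← pd_inner_comp hT hγ]
  unfold pd
  rw [EventuallyEq.fderiv_eq h]

/-- The chain rule for $\gamma\circ T$. In the application $T$ is the curve parameter and $\nu\in
V^\perp$, so that the affine part of $x$ disappears from the pairing. -/
theorem inner_pd_pd_of_eventually {y : E n → F} {T : E n → ℝ} {γ : ℝ → F} {u : E n} {ν : F}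
    (hy : ContDiffAt ℝ 2 y u) (hT : ContDiffAt ℝ 2 T u) (hγ : ContDiffAt ℝ 2 γ (T u))
    (h : ∀ᶠ w in 𝓝 u, inner ℝ ν (y w) = (inner ℝ ν (γ (T w)) : ℝ)) (i j : Fin n) :
    inner ℝ ν (pd i (pd j y) u) = pd i (pd j T) u * inner ℝ ν (deriv γ (T u)) +
      pd i T u * pd j T u * inner ℝ ν (deriv (deriv γ) (T u)) := by
  have hTd := hT.differentiableAt (by norm_num)
  have hγ' : DifferentiableAt ℝ (deriv γ) (T u) :=
    (hγ.derivWithin (m := 1) (by norm_num)).differentiableAt (by norm_num)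
  have h1 : ∀ᶠ w in 𝓝 u, inner ℝ ν (pd j y w) = pd j T w * inner ℝ ν (deriv γ (T w)) := by
    filter_upwards [h.eventually_nhds, hy.eventually (by norm_num), hT.eventually (by norm_num),
      hT.continuousAt.eventually (hγ.eventually (by norm_num))] with w hw hyw hTw hγw
    exact inner_pd_of_eventually (hyw.differentiableAt (by norm_num))
      (hTw.differentiableAt (by norm_num)) (hγw.differentiableAt (by norm_num)) hw j
  rw [← pd_inner_const (differentiableAt_pd hy j)]
  have h2 : pd i (fun w => inner ℝ ν (pd j y w)) u =
      pd i (fun w => pd j T w * inner ℝ ν (deriv γ (T w))) u := by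
    rw [pd, pd, EventuallyEq.fderiv_eq h1]
  have h3 : DifferentiableAt ℝ (fun w => inner ℝ ν (deriv γ (T w))) u :=
    (differentiableAt_const ν).inner ℝ (hγ'.comp u hTd)
  have h4 : pd i (fun w => pd j T w * inner ℝ ν (deriv γ (T w))) u =
      pd j T u * pd i (fun w => inner ℝ ν (deriv γ (T w))) u +
        inner ℝ ν (deriv γ (T u)) * pd i (pd j T) u := by
    rw [pd, fderiv_fun_mul (differentiableAt_pd hT j) h3]
    rfl
  rw [h2, h4, pd_inner_comp hTd hγ']
  ring

theorem deriv_mem_orthogonal {γ : ℝ → F} {V : Submodule ℝ F} {t : ℝ}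
    (hγ : DifferentiableAt ℝ γ t) (h : ∀ᶠ s in 𝓝 t, γ s ∈ Vᗮ) : deriv γ t ∈ Vᗮ := by
  rw [Submodule.mem_orthogonal]
  intro v hv
  have h1 : HasDerivAt (fun s => inner ℝ v (γ s)) (inner ℝ v (deriv γ t)) t := by
    simpa using (hasDerivAt_const t v).inner ℝ hγ.hasDerivAt
  have h2 : HasDerivAt (fun s => (inner ℝ v (γ s) : ℝ)) 0 t :=
    (hasDerivAt_const t (0 : ℝ)).congr_of_eventuallyEq <| by
      filter_upwards [h] with s hs using (Submodule.mem_orthogonal _ _).1 hs v hv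
  exact h1.unique h2

variable {M : Type*} [TopologicalSpace M] [ChartedSpace (E n) M] [IsManifold (𝓡 n) ∞ M]
  {g : Metric n M} {x : M → E (n + 1)} {V : Submodule ℝ (E (n + 1))} {a b : ℝ}
  {γ : ℝ → E (n + 1)} {Φ : PartialDiffeomorph (𝓡 n) 𝓘(ℝ, ℝ × V) M (ℝ × V) ∞}

/-- Differentiating $x\circ\Phi^{-1}=\gamma(t)+v$ shows that $\gamma'$ and $V$ are tangent to the
hypersurface. -/
theorem smul_deriv_add_mem_range_differential (hx : IsIsometricImmersion g x)
    (hγ : ContDiffOn ℝ ∞ γ (Set.Ioo a b)) (hΦ : ∀ q ∈ Φ.source, (Φ q).1 ∈ Set.Ioo a b)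
    (hxΦ : ∀ q ∈ Φ.source, x q = γ (Φ q).1 + ((Φ q).2 : E (n + 1)))
    {q : M} (hq : q ∈ Φ.source) (c : ℝ) (v : V) :
    c • deriv γ (Φ q).1 + (v : E (n + 1)) ∈
      LinearMap.range (differential (n := n) x q).toLinearMap := by
  have hz : Φ q ∈ Φ.target := Φ.map_source hq
  have hleft : Φ.invFun (Φ q) = q := Φ.left_inv hq
  have hγd : DifferentiableAt ℝ γ (Φ q).1 :=
    (hγ.contDiffAt (isOpen_Ioo.mem_nhds (hΦ q hq))).differentiableAt (by simp)
  have hinv : MDifferentiableAt 𝓘(ℝ, ℝ × V) (𝓡 n) Φ.invFun (Φ q) :=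
    (Φ.contMDiffOn_invFun.contMDiffAt (Φ.open_target.mem_nhds hz)).mdifferentiableAt (by simp)
  have h1 : mfderiv 𝓘(ℝ, ℝ × V) 𝓘(ℝ, E (n + 1)) (x ∘ Φ.invFun) (Φ q) (c, v) =
      differential (n := n) x (Φ.invFun (Φ q))
        (mfderiv 𝓘(ℝ, ℝ × V) (𝓡 n) Φ.invFun (Φ q) (c, v)) := by
    rw [mfderiv_comp (Φ q) (hx.mdifferentiable _) hinv]
    rfl
  have h2 : HasFDerivAt (fun z : ℝ × V => γ z.1 + (z.2 : E (n + 1)))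
      ((ContinuousLinearMap.fst ℝ ℝ V).smulRight (deriv γ (Φ q).1) +
        V.subtypeL ∘L ContinuousLinearMap.snd ℝ ℝ V) (Φ q) :=
    (hasFDerivAt_comp_curve hγd.hasDerivAt hasFDerivAt_fst).add
      (V.subtypeL.hasFDerivAt.comp (Φ q) hasFDerivAt_snd)
  have h3 : HasFDerivAt (x ∘ Φ.invFun) ((ContinuousLinearMap.fst ℝ ℝ V).smulRight
      (deriv γ (Φ q).1) + V.subtypeL ∘L ContinuousLinearMap.snd ℝ ℝ V) (Φ q) := by
    refine h2.congr_of_eventuallyEq ?_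
    filter_upwards [Φ.open_target.mem_nhds hz] with z hz
    have h := hxΦ (Φ.invFun z) (Φ.map_target hz)
    rwa [show Φ (Φ.invFun z) = z from Φ.right_inv hz] at h
  rw [mfderiv_eq_fderiv, h3.fderiv] at h1
  have h4 : c • deriv γ (Φ q).1 + (v : E (n + 1)) ∈
      LinearMap.range (differential (n := n) x (Φ.invFun (Φ q))).toLinearMap := ⟨_, h1.symm⟩
  rwa [hleft] at h4

/-- The Laplace map of a product of a planar curve and an affine space is `-γ'' / |γ'|²` in the
directions normal to the hypersurface. -/
theorem inner_laplaceMap_mul_sq (hx : IsIsometricImmersion g x)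
    (hγ : ContDiffOn ℝ ∞ γ (Set.Ioo a b)) (hγV : ∀ t ∈ Set.Ioo a b, γ t ∈ Vᗮ ∧ deriv γ t ≠ 0)
    (hΦ : ∀ q ∈ Φ.source, (Φ q).1 ∈ Set.Ioo a b)
    (hxΦ : ∀ q ∈ Φ.source, x q = γ (Φ q).1 + ((Φ q).2 : E (n + 1)))
    {q : M} (hq : q ∈ Φ.source) {ν : E (n + 1)} (hν : ν ∈ Vᗮ)
    (hν' : inner ℝ ν (deriv γ (Φ q).1) = (0 : ℝ)) :
    inner ℝ ν (laplaceMap g x q) * inner ℝ (deriv γ (Φ q).1) (deriv γ (Φ q).1) =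
      -(inner ℝ ν (deriv (deriv γ) (Φ q).1) : ℝ) := by
  set y := x ∘ param n q with hy
  set u := coord n q with hu
  set T : E n → ℝ := fun w => (Φ (param n q w)).1 with hT
  have hTu : T u = (Φ q).1 := by simp [hT, hu]
  have h2 : (2 : WithTop ℕ∞) ≤ ∞ := WithTop.coe_le_coe.2 (le_top : (2 : ℕ∞) ≤ ⊤)
  have hyc : ContDiffAt ℝ 2 y u := (hx.contDiffAt q (coord_mem_target q)).of_le h2
  have hqu : param n q u = q := param_coord q
  have hΦc : ContMDiffAt (𝓡 n) 𝓘(ℝ, ℝ × V) ∞ Φ (param n q u) := by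
    rw [hqu]
    exact Φ.contMDiffOn_toFun.contMDiffAt (Φ.open_source.mem_nhds hq)
  have hTc : ContDiffAt ℝ 2 T u :=
    (contDiff_fst.contDiffAt.comp u (contDiffAt_comp_param (coord_mem_target q) hΦc)).of_le h2
  have hγc : ContDiffAt ℝ 2 γ (T u) := by
    rw [hTu]
    exact (hγ.contDiffAt (isOpen_Ioo.mem_nhds (hΦ q hq))).of_le h2
  have hev {μ : E (n + 1)} (hμ : μ ∈ Vᗮ) :
      ∀ᶠ w in 𝓝 u, inner ℝ μ (y w) = (inner ℝ μ (γ (T w)) : ℝ) := by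
    have hcont : ContinuousAt (param n q) u :=
      (contMDiffAt_param q (coord_mem_target q)).continuousAt
    filter_upwards [hcont.eventually (Φ.open_source.mem_nhds (by rwa [hqu]))] with w hw
    rw [hy, Function.comp_apply, hxΦ _ hw, inner_add_right,
      (Submodule.mem_orthogonal' _ _).1 hμ _ (Φ (param n q w)).2.2, add_zero]
  have hγ'V : deriv γ (T u) ∈ Vᗮ := by
    refine deriv_mem_orthogonal (hγc.differentiableAt (by norm_num)) ?_
    rw [hTu]
    filter_upwards [isOpen_Ioo.mem_nhds (hΦ q hq)] with s hs using (hγV s hs).1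
  rw [← hTu] at hν' ⊢
  set κ : ℝ := inner ℝ (deriv γ (T u)) (deriv γ (T u)) with hκ
  have hκ0 : κ ≠ 0 := inner_self_ne_zero.2 (by rw [hTu]; exact (hγV _ (hΦ q hq)).2)
  have hfirst {μ : E (n + 1)} (hμ : μ ∈ Vᗮ) (i : Fin n) :
      inner ℝ μ (pd i y u) = pd i T u * inner ℝ μ (deriv γ (T u)) :=
    inner_pd_of_eventually (hyc.differentiableAt (by norm_num))
      (hTc.differentiableAt (by norm_num)) (hγc.differentiableAt (by norm_num)) (hev hμ) i
  -- That is, $|\nabla T|^2=1/\kappa$: as $\langle\gamma',\partial_i x\rangle=\kappa\,\partial_iT$,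
  -- expanding $|\gamma'|^2=\kappa$ through the inverse Gram matrix gives $\kappa^2|\nabla
  -- T|^2=\kappa$.
  have hsum : (∑ i, ∑ j, (gram g q u)⁻¹ i j * (pd i T u * pd j T u)) * κ = 1 := by
    have hmem : deriv γ (T u) ∈ Submodule.span ℝ (Set.range fun i => pd i y u) := by
      rw [← range_differential (hx.mdifferentiable q), hTu]
      simpa using smul_deriv_add_mem_range_differential hx hγ hΦ hxΦ hq 1 0
    have h := sum_inv_gram_inner (fun i j => hx.gram_apply q (coord_mem_target q) i j)
      (hx.isUnit_det_gram q) hmem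
    refine mul_right_cancel₀ hκ0 ?_
    rw [one_mul]
    nth_rewrite 3 [hκ]
    rw [← h, Finset.sum_mul, Finset.sum_mul]
    refine Finset.sum_congr rfl fun i _ => ?_
    rw [Finset.sum_mul, Finset.sum_mul]
    refine Finset.sum_congr rfl fun j _ => ?_
    rw [real_inner_comm, hfirst hγ'V, real_inner_comm (deriv γ (T u)) (pd j (x ∘ param n q) _),
      hfirst hγ'V]
    ring
  -- The Christoffel terms and the $\partial_i\partial_jT$ terms carry the factor
  -- $\langle\nu,\gamma'\rangle=0$.
  have hL : inner ℝ ν (laplaceMap g x q) =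
      -((∑ i, ∑ j, (gram g q u)⁻¹ i j * (pd i T u * pd j T u)) *
        inner ℝ ν (deriv (deriv γ) (T u))) := by
    simp only [laplaceMap, laplacian, inner_neg_right, inner_sum, real_inner_smul_right,
      inner_sub_right, ← hu, ← hy, hfirst hν, hν', mul_zero, Finset.sum_const_zero, sub_zero,
      inner_pd_pd_of_eventually hyc hTc hγc (hev hν), zero_add, Finset.sum_mul]
    simp only [mul_assoc]
  rw [hL, neg_mul, mul_right_comm, hsum, one_mul]

/-- On a product of a planar curve and an affine space of positive dimension the Laplace map is
constant along the affine spaces, hence not an immersion. -/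
theorem not_isCurveProductNear (hn : 2 ≤ n) (hx : IsIsometricImmersion g x)
    (hL : IsSmoothImmersion (n := n) (laplaceMap g x)) (p : M) :
    ¬ IsCurveProductNear (n := n) x p := by
  rintro ⟨V, a, b, W, γ, Φ, hV, hγ, hγV, hp, htarget, hxΦ⟩
  have hΦ : ∀ q ∈ Φ.source, (Φ q).1 ∈ Set.Ioo a b := fun q hq => by
    have h : Φ q ∈ Φ.target := Φ.map_source hq
    rw [htarget] at h
    exact h.1
  have hrange {q : M} (hq : q ∈ Φ.source) : laplaceMap g x q ∈ Vᗮ ∧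
      inner ℝ (laplaceMap g x q) (deriv γ (Φ q).1) = (0 : ℝ) := by
    have horth := (Submodule.mem_orthogonal' _ _).1 (hx.laplaceMap_mem_orthogonal q)
    have hmem := smul_deriv_add_mem_range_differential hx hγ hΦ hxΦ hq
    refine ⟨(Submodule.mem_orthogonal' _ _).2 fun v hv => ?_, ?_⟩
    · simpa using horth _ (hmem 0 ⟨v, hv⟩)
    · simpa using horth _ (hmem 1 0)
  -- The difference $d$ of the two Laplace vectors is orthogonal to $V$ and $\gamma'$, so it can
  -- serve as the test vector $\nu$ at both points; the results agree, whence $\langle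
  -- d,d\rangle=0$.
  have hconst {q : M} (hq : q ∈ Φ.source) (hqp : (Φ q).1 = (Φ p).1) :
      laplaceMap g x q = laplaceMap g x p := by
    set d := laplaceMap g x q - laplaceMap g x p with hd
    have hdV : d ∈ Vᗮ := Submodule.sub_mem _ (hrange hq).1 (hrange hp).1
    have hdγ : inner ℝ d (deriv γ (Φ p).1) = (0 : ℝ) := by
      have h := (hrange hq).2
      rw [hqp] at h
      rw [hd, inner_sub_left, h, (hrange hp).2, sub_zero]
    have h1 := inner_laplaceMap_mul_sq hx hγ hγV hΦ hxΦ hq hdV (by rwa [hqp])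
    have h2 := inner_laplaceMap_mul_sq hx hγ hγV hΦ hxΦ hp hdV hdγ
    rw [hqp, ← h2] at h1
    have h3 := mul_right_cancel₀ (inner_self_ne_zero.2 (hγV _ (hΦ p hp)).2) h1
    have h4 : inner ℝ d d = (0 : ℝ) := by
      nth_rewrite 2 [hd]
      rw [inner_sub_right, h3, sub_self]
    exact sub_eq_zero.1 (inner_self_eq_zero.1 h4)
  obtain ⟨U, hU, hpU, hinj⟩ := hL.exists_injOn p
  have : Nontrivial V := Module.nontrivial_of_finrank_pos (R := ℝ) (by omega)
  obtain ⟨v, hv⟩ := exists_ne (0 : V)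
  -- A line through $\Phi(p)$ in the affine factor: $L$ is constant on its preimage, yet points with
  -- small $s\ne 0$ lie in the set where $L$ is injective.
  set c : ℝ → ℝ × V := fun s => ((Φ p).1, (Φ p).2 + s • v) with hc
  have hc0 : c 0 = Φ p := by simp [hc]
  have hpt : Φ p ∈ Φ.target := Φ.map_source hp
  have hcc : ContinuousAt c 0 := by fun_prop
  have hinvc : ContinuousAt Φ.invFun (c 0) := by
    rw [hc0]
    exact Φ.contMDiffOn_invFun.continuousOn.continuousAt (Φ.open_target.mem_nhds hpt)
  have hΦp : Φ.invFun (c 0) = p := by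
    rw [hc0]
    exact Φ.left_inv hp
  have hev : ∀ᶠ s in 𝓝 (0 : ℝ), c s ∈ Φ.target ∧ Φ.invFun (c s) ∈ U :=
    (hcc.eventually (Φ.open_target.mem_nhds (by rwa [hc0]))).and
      ((hinvc.comp hcc).eventually (hU.mem_nhds (by rwa [Function.comp_apply, hΦp])))
  obtain ⟨s, ⟨hst, hsU⟩, hs0⟩ :=
    ((hev.filter_mono nhdsWithin_le_nhds).and self_mem_nhdsWithin :
      ∀ᶠ s in 𝓝[≠] (0 : ℝ), _ ∧ s ∈ ({0}ᶜ : Set ℝ)).exists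
  have hcs : Φ (Φ.invFun (c s)) = c s := Φ.right_inv hst
  have heq : Φ.invFun (c s) = p :=
    hinj hsU hpU (hconst (Φ.map_target hst) (by rw [hcs]))
  rw [heq] at hcs
  have h5 : (Φ p).2 = (Φ p).2 + s • v := congrArg Prod.snd hcs
  rw [left_eq_add, smul_eq_zero] at h5
  exact h5.elim hs0 hv

end CurveProduct

end LaplaceGauss

theorem mainTheorem10 (n : ℕ) (hn : 2 ≤ n)
    {M : Type*} [TopologicalSpace M] [ChartedSpace (LaplaceGauss.E n) M]
    [IsManifold (𝓡 n) ∞ M]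
    (g : LaplaceGauss.Metric n M)
    (x : M → LaplaceGauss.E (n + 1)) (hx : LaplaceGauss.IsIsometricImmersion g x)
    (G : M → LaplaceGauss.E (n + 1)) (hG : LaplaceGauss.IsGaussMap (n := n) x G)
    (hL : LaplaceGauss.IsSmoothImmersion (n := n) (LaplaceGauss.laplaceMap g x)) :
    LaplaceGauss.LGWeaklyConformal (n := n) (LaplaceGauss.laplaceMap g x) G ↔
      ∀ p : M, LaplaceGauss.HasConstantMeanCurvatureNear g x p ∨
        LaplaceGauss.IsCurveProductNear (n := n) x p := by
  refine ⟨fun h p => Or.inl (hx.hasConstantMeanCurvatureNear hn hG hL h p), fun h p => ?_⟩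
  exact ((h p).resolve_right
    (LaplaceGauss.not_isCurveProductNear hn hx hL p)).exists_isWeaklyConformalOnImage hn hx hG hL
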